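/- Let $\mathcal{Y}$ be a connected small category without loops (scwol), with vertex set $V(\mathcal{Y})$, edge set $E(\mathcal{Y})$ and initial and terminal vertex maps $i,t$, and let $G(\mathcal{Y})=(G_\sigma,\psi_a,g_{a,b})$ be a developable complex of groups over $\mathcal{Y}$, i.e. one that is isomorphic to the complex of groups of an action of a group on a scwol with quotient $\mathcal{Y}$. Let $FG(\mathcal{Y})$ be the quotient of the free product of the local groups $G_\sigma$ and the free group on the symbols $a^+,a^-$ ($a\in E(\mathcal{Y})$) by the relations $(a^+)^{-1}=a^-$, $(a^-)^{-1}=a^+$, $a^+b^+=g_{a,b}(ab)^+$ for composable $(a,b)$, and $\psi_a(g)=a^+ga^-$ for $g\in G_{i(a)}$. Put $i(a^+)=t(a^-)=t(a)$ and $t(a^+)=i(a^-)=i(a)$. A $G(\mathcal{Y})$-path from $\sigma$ to $\tau$ is a sequence $c=(g_0,e_1,g_1,\dots,e_k,g_k)$, where $(e_1,\dots,e_k)$ is an edge path of such oriented edges from $\sigma$ to $\tau$, $g_0\in G_\sigma$ and $g_j\in G_{t(e_j)}$ for $j\ge 1$. Its length is $k$ and its word is $g_0e_1g_1\cdots e_kg_k\in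 FG(\mathcal{Y})$. Two $G(\mathcal{Y})$-paths with the same endpoints are homotopic if their words are equal in $FG(\mathcal{Y})$, and $c$ is reduced if no $G(\mathcal{Y})$-path homotopic to $c$ is shorter than $c$. For a vertex $\sigma_0$, $\pi_1(G(\mathcal{Y}),\sigma_0)\le FG(\mathcal{Y})$ is the group of the words of the $G(\mathcal{Y})$-loops based at $\sigma_0$. Let $T$ be a maximal tree in the $1$-skeleton $|\mathcal{Y}|^{(1)}$, and let $G=\pi_1(G(\mathcal{Y}),T)$ be the quotient of $FG(\mathcal{Y})$ by the relations $a^+=1$ for all edges $a$ of $T$. Let $\mathcal{X}$ be the (simply connected) development of $G(\mathcal{Y})$: its vertices are the pairs $(gG_\sigma,\sigma)$ with $\sigma\in V(\mathcal{Y})$, $g\in G$, and its edges are the pairs $(gG_{i(a)},a)$ with $a\in E(\mathcal{Y})$, $g\in G$, going from $(gG_{i(a)},i(a))$ to $(ga^-G_{t(a)},t(a))$. The group $\pi_1(G(\mathcal{Y}),\sigma_0)$ acts on $\mathcal{X}$ by left multiplication, through the canonical homomorphism $\pi_1(G(\mathcal{Y}),\sigma_0)\to\pi_1(G(\mathcal{Y}),T)$.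 Equip $V(\mathcal{X})$ with the edge-path metric $d_{\mathcal{X}}$ (the least number of edges of an edge path in $\mathcal{X}$ joining two vertices), for which the action is isometric, and let $\tilde\sigma_0=(G_{\sigma_0},\sigma_0)$ be the base vertex of $\mathcal{X}$. Then for every real $R>0$ the $R$-stabilizer $W_R(\sigma_0)=\{\gamma\in\pi_1(G(\mathcal{Y}),\sigma_0)\mid d_{\mathcal{X}}(\gamma\tilde\sigma_0,\tilde\sigma_0)\le R\}$ is exactly the set of all $\gamma\in\pi_1(G(\mathcal{Y}),\sigma_0)$ that are represented by a reduced $G(\mathcal{Y})$-loop based at $\sigma_0$ of length at most $R$. -/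

import Mathlib

universe u v w

set_option linter.checkUnivs false

/-- A small category without loops. The edge set `E` of the scwol is presented as the family of sets
`Edge x y` of edges `a` with initial vertex `i(a) = x` and terminal vertex `t(a) = y`.
`comp a b` is the composition `ab` of a pair of composable edges, `i(a) = t(b)`. -/
structure Scwol where
  V : Type u
  Edge : V → V → Type v
  comp : ∀ {x y z : V}, Edge y z → Edge x y → Edge x z
  comp_assoc : ∀ {x y z z' : V} (a : Edge z z') (b : Edge y z) (c : Edge x y),
    comp a (comp b c) = comp (comp a b) c
  no_loops : ∀ x : V, IsEmpty (Edge x x)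

namespace Scwol

/-- The set of all edges of a scwol; `⟨x, y, a⟩` is the edge `a` with `i(a) = x` and `t(a) = y`. -/
abbrev E (X : Scwol.{u, v}) : Type (max u v) := Σ x y : X.V, X.Edge x y

/-- The 1-skeleton of the geometric realization, up to parallel edges. -/
def skeleton (X : Scwol.{u, v}) : SimpleGraph X.V where
  Adj x y := Nonempty (X.Edge x y) ∨ Nonempty (X.Edge y x)
  symm := ⟨fun _ _ h => h.symm⟩
  loopless := ⟨fun x h => by
    rcases h with h | h <;> exact h.elim (X.no_loops x).false⟩

/-- The edge-path metric on the vertex set of a connected scwol: the distance of two vertices is the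
least number of edges of an edge path joining them. -/
@[reducible]
noncomputable def edgePathMetric (X : Scwol.{u, v}) (hX : X.skeleton.Connected) :
    MetricSpace X.V where
  dist x y := (X.skeleton.dist x y : ℝ)
  dist_self x := by simp
  dist_comm x y := by rw [SimpleGraph.dist_comm]
  dist_triangle x y z := by exact_mod_cast hX.dist_triangle
  eq_of_dist_eq_zero {x y} h := by
    have h' : X.skeleton.dist x y = 0 := by exact_mod_cast h
    exact hX.dist_eq_zero_iff.mp h'

/-- An action of a group on a scwol: an action by automorphisms such that no element maps the
initial vertex of an edge to the terminal vertex of this edge, and an element that fixes the initial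
vertex of an edge fixes the edge. -/
class Action (Γ : Type*) [Group Γ] (X : Scwol.{u, v}) extends MulAction Γ X.V where
  smulEdge : ∀ (g : Γ) {x y : X.V}, X.Edge x y → X.Edge (g • x) (g • y)
  one_smulEdge : ∀ {x y : X.V} (a : X.Edge x y),
    (⟨_, _, smulEdge 1 a⟩ : X.E) = ⟨x, y, a⟩
  mul_smulEdge : ∀ (g h : Γ) {x y : X.V} (a : X.Edge x y),
    (⟨_, _, smulEdge (g * h) a⟩ : X.E) = ⟨_, _, smulEdge g (smulEdge h a)⟩
  smulEdge_comp : ∀ (g : Γ) {x y z : X.V} (a : X.Edge y z) (b : X.Edge x y),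
    smulEdge g (X.comp a b) = X.comp (smulEdge g a) (smulEdge g b)
  smul_initial_ne_terminal : ∀ (g : Γ) {x y : X.V}, X.Edge x y → g • x ≠ y
  smulEdge_eq_of_fixed : ∀ (g : Γ) {x y : X.V} (a : X.Edge x y), g • x = x →
    (⟨_, _, smulEdge g a⟩ : X.E) = ⟨x, y, a⟩

/-- The action of `Γ` obtained from an action of `Δ` through a homomorphism `Γ →* Δ`. -/
@[reducible]
def Action.pullback {Γ Δ : Type*} [Group Γ] [Group Δ] (X : Scwol.{u, v}) [Action Δ X]
    (f : Γ →* Δ) : Action Γ X where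
  toMulAction := MulAction.compHom X.V f
  smulEdge g _ _ a := Action.smulEdge (f g) a
  one_smulEdge a := by
    have h := Action.one_smulEdge (Γ := Δ) a
    rw [← map_one f] at h
    exact h
  mul_smulEdge g h _ _ a := by
    have h' := Action.mul_smulEdge (f g) (f h) a
    rw [← map_mul f] at h'
    exact h'
  smulEdge_comp g _ _ _ a b := Action.smulEdge_comp (f g) a b
  smul_initial_ne_terminal g _ _ a := Action.smul_initial_ne_terminal (f g) a
  smulEdge_eq_of_fixed g _ _ a h := Action.smulEdge_eq_of_fixed (f g) a h

/-- A group acting on a scwol acts on the 1-skeleton. -/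
def Action.skeletonHom {Γ : Type*} [Group Γ] (X : Scwol.{u, v}) [Action Γ X] (g : Γ) :
    X.skeleton →g X.skeleton where
  toFun x := g • x
  map_rel' h := h.imp (fun ⟨a⟩ => ⟨Action.smulEdge g a⟩) (fun ⟨a⟩ => ⟨Action.smulEdge g a⟩)

theorem dist_smul_le {Γ : Type*} [Group Γ] {X : Scwol.{u, v}} [Action Γ X]
    (hX : X.skeleton.Connected) (g : Γ) (x y : X.V) :
    X.skeleton.dist (g • x) (g • y) ≤ X.skeleton.dist x y := by
  obtain ⟨p, hp⟩ := (hX x y).exists_walk_length_eq_dist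
  rw [← hp, ← SimpleGraph.Walk.length_map (Action.skeletonHom X g) p]
  exact SimpleGraph.dist_le _

theorem dist_smul_eq {Γ : Type*} [Group Γ] {X : Scwol.{u, v}} [Action Γ X]
    (hX : X.skeleton.Connected) (g : Γ) (x y : X.V) :
    X.skeleton.dist (g • x) (g • y) = X.skeleton.dist x y := by
  refine le_antisymm (dist_smul_le hX g x y) ?_
  simpa using dist_smul_le hX g⁻¹ (g • x) (g • y)

/-- An identification of the scwol `Y` with the quotient scwol `Γ \ X`: a surjective morphism of
scwols `X → Y` whose fibres, on vertices and on edges, are the orbits of `Γ`. -/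
structure QuotientMap (Γ : Type*) [Group Γ] (X : Scwol) [Action Γ X] (Y : Scwol) where
  onV : X.V → Y.V
  onEdge : ∀ {x y : X.V}, X.Edge x y → Y.Edge (onV x) (onV y)
  onEdge_comp : ∀ {x y z : X.V} (a : X.Edge y z) (b : X.Edge x y),
    onEdge (X.comp a b) = Y.comp (onEdge a) (onEdge b)
  surjective_onV : Function.Surjective onV
  surjective_onEdge : Function.Surjective
    (fun e : X.E => (⟨_, _, onEdge e.2.2⟩ : Y.E))
  onV_eq_iff : ∀ x y : X.V, onV x = onV y ↔ ∃ g : Γ, g • x = y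
  onEdge_eq_iff : ∀ {x y x' y' : X.V} (a : X.Edge x y) (b : X.Edge x' y'),
    (⟨_, _, onEdge a⟩ : Y.E) = ⟨_, _, onEdge b⟩ ↔
      ∃ g : Γ, (⟨_, _, Action.smulEdge g a⟩ : X.E) = ⟨_, _, b⟩

/-- The graph with vertex set `V(X)` whose edges are the edges of `X` that belong to `S`. -/
def subgraph (X : Scwol.{u, v}) (S : Set X.E) : SimpleGraph X.V where
  Adj x y := (∃ a : X.Edge x y, (⟨x, y, a⟩ : X.E) ∈ S) ∨
    (∃ a : X.Edge y x, (⟨y, x, a⟩ : X.E) ∈ S)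
  symm := ⟨fun _ _ h => h.symm⟩
  loopless := ⟨fun x h => by
    rcases h with ⟨a, _⟩ | ⟨a, _⟩ <;> exact (X.no_loops x).false a⟩

/-- A maximal tree in the 1-skeleton of a (connected) scwol: a set of edges that contains no two
edges with the same endpoints and whose edges form a tree on the set of all vertices. -/
structure MaximalTree (X : Scwol.{u, v}) where
  edges : Set X.E
  no_parallel : ∀ {x y : X.V} (a b : X.Edge x y),
    (⟨x, y, a⟩ : X.E) ∈ edges → (⟨x, y, b⟩ : X.E) ∈ edges → a = b
  isTree : (X.subgraph edges).IsTree

/-- The oriented edges from `x` to `y`: an edge `a` gives `a⁺` with `i(a⁺) = t(a)`, `t(a⁺) = i(a)`,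
and `a⁻` with `i(a⁻) = i(a)`, `t(a⁻) = t(a)`. -/
inductive OrientedEdge (X : Scwol.{u, v}) (x y : X.V) : Type v
  | pos (a : X.Edge y x) : OrientedEdge X x y
  | neg (a : X.Edge x y) : OrientedEdge X x y

/-- The set `E^±` of all symbols `a⁺`, `a⁻`. -/
abbrev OE (X : Scwol.{u, v}) : Type (max u v) := Σ x y : X.V, X.OrientedEdge x y

/-- The symbol `a⁺`. -/
def posSymbol (X : Scwol.{u, v}) {x y : X.V} (a : X.Edge x y) : X.OE :=
  ⟨y, x, OrientedEdge.pos a⟩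

/-- The symbol `a⁻`. -/
def negSymbol (X : Scwol.{u, v}) {x y : X.V} (a : X.Edge x y) : X.OE :=
  ⟨x, y, OrientedEdge.neg a⟩

end Scwol

/-- A complex of groups `(G_σ, ψ_a, g_{a,b})` over a scwol `Y`; `twist a b` is `g_{a,b}`. -/
structure ComplexOfGroups (Y : Scwol.{u, v}) where
  G : Y.V → Type w
  [group : ∀ σ, Group (G σ)]
  ψ : ∀ {σ τ : Y.V}, Y.Edge σ τ → (G σ →* G τ)
  ψ_injective : ∀ {σ τ : Y.V} (a : Y.Edge σ τ), Function.Injective (ψ a)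
  twist : ∀ {σ ρ τ : Y.V}, Y.Edge ρ τ → Y.Edge σ ρ → G τ
  conj_twist : ∀ {σ ρ τ : Y.V} (a : Y.Edge ρ τ) (b : Y.Edge σ ρ) (g : G σ),
    twist a b * ψ (Y.comp a b) g * (twist a b)⁻¹ = ψ a (ψ b g)
  cocycle : ∀ {σ ρ τ τ' : Y.V} (a : Y.Edge τ τ') (b : Y.Edge ρ τ) (c : Y.Edge σ ρ),
    ψ a (twist b c) * twist a (Y.comp b c) = twist a b * twist (Y.comp a b) c

namespace ComplexOfGroups

attribute [instance] ComplexOfGroups.group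

variable {Y : Scwol.{u, v}} (𝒢 : ComplexOfGroups.{u, v, w} Y)

/-- A complex of groups over `Y` is developable if it is isomorphic to the complex of groups of an
action of a group `Γ` on a scwol `X` with quotient `Y`. The latter depends on choices: a lift
`s σ ∈ V(X)` of each vertex `σ` of `Y`, and, if `ã` denotes the (unique) lift of the edge `a` of `Y`
with `i(ã) = s (i(a))`, an element `h a ∈ Γ` with `h a • t(ã) = s (t(a))`. The local group at
`σ` is the stabilizer of `s σ`, the homomorphism of `a` is the conjugation by `h a`, and
`g_{a,b} = h a * h b * (h (ab))⁻¹`. An isomorphism of complexes of groups consists of isomorphisms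
`φ σ` of the local groups and of elements `u_a` of the target local groups; since every choice of
`h` is allowed here, `h a` may be replaced with `u_a * h a`, so that all `u_a` are trivial. -/
def IsDevelopable : Prop :=
  ∃ (Γ : Type (max u v w)) (_ : Group Γ) (X : Scwol.{max u v w, v}) (_ : Scwol.Action Γ X)
    (p : Scwol.QuotientMap Γ X Y)
    (s : Y.V → X.V)
    (h : ∀ {σ τ : Y.V}, Y.Edge σ τ → Γ)
    (lift : ∀ {σ τ : Y.V} (a : Y.Edge σ τ), X.Edge (s σ) ((h a)⁻¹ • s τ))
    (φ : ∀ σ : Y.V, 𝒢.G σ ≃* MulAction.stabilizer Γ (s σ)),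
    (∀ σ, p.onV (s σ) = σ) ∧
    (∀ {σ τ : Y.V} (a : Y.Edge σ τ), (⟨_, _, p.onEdge (lift a)⟩ : Y.E) = ⟨σ, τ, a⟩) ∧
    (∀ {σ τ : Y.V} (a : Y.Edge σ τ) (g : 𝒢.G σ),
      (φ τ (𝒢.ψ a g) : Γ) = h a * (φ σ g : Γ) * (h a)⁻¹) ∧
    (∀ {σ ρ τ : Y.V} (a : Y.Edge ρ τ) (b : Y.Edge σ ρ),
      (φ τ (𝒢.twist a b) : Γ) = h a * h b * (h (Y.comp a b))⁻¹)

/-! ### The auxiliary group `FG(Y)` -/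

/-- The free product of the local groups and of the free group on `E^±`. -/
abbrev FreeProd : Type (max u v w) := Monoid.Coprod (Monoid.CoprodI 𝒢.G) (FreeGroup Y.OE)

/-- An element of a local group, in the free product. -/
def preLocal (σ : Y.V) : 𝒢.G σ →* 𝒢.FreeProd :=
  Monoid.Coprod.inl.comp Monoid.CoprodI.of

/-- An oriented edge, in the free product. -/
def preEdge (e : Y.OE) : 𝒢.FreeProd := Monoid.Coprod.inr (FreeGroup.of e)

/-- The relators of `FG(Y)`; a relation `l = r` gives the relator `l * r⁻¹`. -/
inductive FGRel : 𝒢.FreeProd → Prop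
  | inv_pos {σ τ : Y.V} (a : Y.Edge σ τ) :
      FGRel ((𝒢.preEdge (Y.posSymbol a))⁻¹ * (𝒢.preEdge (Y.negSymbol a))⁻¹)
  | inv_neg {σ τ : Y.V} (a : Y.Edge σ τ) :
      FGRel ((𝒢.preEdge (Y.negSymbol a))⁻¹ * (𝒢.preEdge (Y.posSymbol a))⁻¹)
  | comp {σ ρ τ : Y.V} (a : Y.Edge ρ τ) (b : Y.Edge σ ρ) :
      FGRel (𝒢.preEdge (Y.posSymbol a) * 𝒢.preEdge (Y.posSymbol b) *
        (𝒢.preLocal τ (𝒢.twist a b) * 𝒢.preEdge (Y.posSymbol (Y.comp a b)))⁻¹)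
  | conj {σ τ : Y.V} (a : Y.Edge σ τ) (g : 𝒢.G σ) :
      FGRel (𝒢.preLocal τ (𝒢.ψ a g) *
        (𝒢.preEdge (Y.posSymbol a) * 𝒢.preLocal σ g * 𝒢.preEdge (Y.negSymbol a))⁻¹)

/-- The group `FG(Y)`. -/
abbrev FG : Type (max u v w) := 𝒢.FreeProd ⧸ Subgroup.normalClosure {x | 𝒢.FGRel x}

/-- The homomorphism from a local group to `FG(Y)`. -/
def ofLocal (σ : Y.V) : 𝒢.G σ →* 𝒢.FG := (QuotientGroup.mk' _).comp (𝒢.preLocal σ)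

/-- The element of `FG(Y)` given by an oriented edge. -/
def ofEdge {σ τ : Y.V} (e : Y.OrientedEdge σ τ) : 𝒢.FG :=
  QuotientGroup.mk' _ (𝒢.preEdge ⟨σ, τ, e⟩)

/-- The element `a⁺` of `FG(Y)`. -/
def pos {σ τ : Y.V} (a : Y.Edge σ τ) : 𝒢.FG := 𝒢.ofEdge (Scwol.OrientedEdge.pos a)

/-- The element `a⁻` of `FG(Y)`. -/
def neg {σ τ : Y.V} (a : Y.Edge σ τ) : 𝒢.FG := 𝒢.ofEdge (Scwol.OrientedEdge.neg a)

theorem mk_eq_one {x : 𝒢.FreeProd} (h : 𝒢.FGRel x) :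
    (QuotientGroup.mk' (Subgroup.normalClosure {x | 𝒢.FGRel x})) x = 1 :=
  (QuotientGroup.eq_one_iff x).mpr (Subgroup.subset_normalClosure h)

theorem neg_eq {σ τ : Y.V} (a : Y.Edge σ τ) : 𝒢.neg a = (𝒢.pos a)⁻¹ := by
  have h := 𝒢.mk_eq_one (FGRel.inv_pos a)
  rw [map_mul, map_inv, map_inv, mul_inv_eq_one] at h
  exact h.symm

theorem pos_mul_pos {σ ρ τ : Y.V} (a : Y.Edge ρ τ) (b : Y.Edge σ ρ) :
    𝒢.pos a * 𝒢.pos b = 𝒢.ofLocal τ (𝒢.twist a b) * 𝒢.pos (Y.comp a b) := by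
  have h := 𝒢.mk_eq_one (FGRel.comp a b)
  rw [map_mul, map_inv, mul_inv_eq_one, map_mul, map_mul] at h
  exact h

theorem ofLocal_ψ {σ τ : Y.V} (a : Y.Edge σ τ) (g : 𝒢.G σ) :
    𝒢.ofLocal τ (𝒢.ψ a g) = 𝒢.pos a * 𝒢.ofLocal σ g * (𝒢.pos a)⁻¹ := by
  have h := 𝒢.mk_eq_one (FGRel.conj a g)
  rw [map_mul, map_inv, mul_inv_eq_one, map_mul, map_mul] at h
  rw [← neg_eq]
  exact h

theorem FG_induction {P : 𝒢.FG → Prop} (one : P 1) (mul : ∀ x y, P x → P y → P (x * y))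
    (inv : ∀ x, P x → P x⁻¹) (local_mem : ∀ σ g, P (𝒢.ofLocal σ g))
    (pos_mem : ∀ {σ τ : Y.V} (a : Y.Edge σ τ), P (𝒢.pos a)) (x : 𝒢.FG) : P x := by
  obtain ⟨x, rfl⟩ := QuotientGroup.mk'_surjective _ x
  induction x using Monoid.Coprod.induction_on with
  | inl m =>
    induction m using Monoid.CoprodI.induction_on with
    | one => simpa using one
    | of i m => exact local_mem i m
    | mul x y hx hy => rw [map_mul, map_mul]; exact mul _ _ hx hy
  | inr n =>
    induction n using FreeGroup.induction_on with
    | C1 => simpa using one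
    | of e =>
      obtain ⟨σ, τ, a | a⟩ := e
      · exact pos_mem a
      · have h := inv _ (pos_mem a)
        rw [← neg_eq] at h
        exact h
    | inv_of e h => rw [map_inv, map_inv]; exact inv _ h
    | mul x y hx hy => rw [map_mul, map_mul]; exact mul _ _ hx hy
  | mul x y hx hy => rw [map_mul]; exact mul _ _ hx hy

/-! ### `G(Y)`-paths and the fundamental group at a vertex -/

/-- A `G(Y)`-path `(g_0, e_1, g_1, …, e_k, g_k)` from `σ` to `τ`: `g_0` is in the local group at
`σ = i(e_1)`, `t(e_i) = i(e_{i+1})`, `g_i` is in the local group at `t(e_i)`, and `t(e_k) = τ`. -/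
inductive GPath : Y.V → Y.V → Type (max u v w)
  | nil {σ : Y.V} (g : 𝒢.G σ) : GPath σ σ
  | cons {σ ρ τ : Y.V} (g : 𝒢.G σ) (e : Y.OrientedEdge σ ρ) (c : GPath ρ τ) : GPath σ τ

namespace GPath

variable {𝒢}

/-- The number `k` of edges of a `G(Y)`-path. -/
def length : ∀ {σ τ : Y.V}, 𝒢.GPath σ τ → ℕ
  | _, _, nil _ => 0
  | _, _, cons _ _ c => c.length + 1

/-- The element `g_0 e_1 g_1 ⋯ e_k g_k` of `FG(Y)`. -/
def word : ∀ {σ τ : Y.V}, 𝒢.GPath σ τ → 𝒢.FG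
  | σ, _, nil g => 𝒢.ofLocal σ g
  | σ, _, cons g e c => 𝒢.ofLocal σ g * 𝒢.ofEdge e * c.word

/-- Two `G(Y)`-paths with the same endpoints are homotopic if their words are equal in `FG(Y)`. -/
def Homotopic {σ τ : Y.V} (c c' : 𝒢.GPath σ τ) : Prop := c.word = c'.word

/-- A `G(Y)`-path is reduced if no homotopic `G(Y)`-path has fewer edges. -/
def IsReduced {σ τ : Y.V} (c : 𝒢.GPath σ τ) : Prop :=
  ∀ c' : 𝒢.GPath σ τ, c'.Homotopic c → c.length ≤ c'.length

theorem exists_word_local_mul {σ τ : Y.V} (g : 𝒢.G σ) (c : 𝒢.GPath σ τ) :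
    ∃ c' : 𝒢.GPath σ τ, c'.word = 𝒢.ofLocal σ g * c.word := by
  cases c with
  | nil g' => exact ⟨nil (g * g'), by simp [word]⟩
  | cons g' e c => exact ⟨cons (g * g') e c, by simp [word, mul_assoc]⟩

theorem exists_word_mul {σ ρ τ : Y.V} (c : 𝒢.GPath σ ρ) (d : 𝒢.GPath ρ τ) :
    ∃ c' : 𝒢.GPath σ τ, c'.word = c.word * d.word := by
  induction c with
  | nil g => exact exists_word_local_mul g d
  | cons g e c ih =>
    obtain ⟨c', hc'⟩ := ih d
    exact ⟨cons g e c', by simp [word, hc', mul_assoc]⟩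

theorem exists_word_inv_edge {σ τ : Y.V} (e : Y.OrientedEdge σ τ) :
    ∃ c : 𝒢.GPath τ σ, c.word = (𝒢.ofEdge e)⁻¹ := by
  rcases e with a | a
  · exact ⟨cons 1 (.neg a) (nil 1), by
      rw [word, word, map_one, map_one, one_mul, mul_one]; exact 𝒢.neg_eq a⟩
  · refine ⟨cons 1 (.pos a) (nil 1), ?_⟩
    rw [word, word, map_one, map_one, one_mul, mul_one]
    exact (inv_eq_iff_eq_inv.mpr (𝒢.neg_eq a)).symm

theorem exists_word_inv {σ τ : Y.V} (c : 𝒢.GPath σ τ) :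
    ∃ c' : 𝒢.GPath τ σ, c'.word = c.word⁻¹ := by
  induction c with
  | nil g => exact ⟨nil g⁻¹, by simp [word]⟩
  | cons g e c ih =>
    obtain ⟨c', hc'⟩ := ih
    obtain ⟨d, hd⟩ := exists_word_inv_edge (𝒢 := 𝒢) e
    obtain ⟨k, hk⟩ := exists_word_mul c' d
    obtain ⟨l, hl⟩ := exists_word_mul k (nil g⁻¹)
    exact ⟨l, by simp [hl, hk, hc', hd, word, mul_assoc]⟩

end GPath

/-- The fundamental group of a complex of groups at `σ₀`: the group of the homotopy classes of the
`G(Y)`-loops based at `σ₀`, that is, of their words in `FG(Y)`. -/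
def fundamentalGroup (σ₀ : Y.V) : Subgroup 𝒢.FG where
  carrier := {x | ∃ c : 𝒢.GPath σ₀ σ₀, c.word = x}
  one_mem' := ⟨.nil 1, by simp [GPath.word]⟩
  mul_mem' := by
    rintro _ _ ⟨c, rfl⟩ ⟨d, rfl⟩
    exact GPath.exists_word_mul c d
  inv_mem' := by
    rintro _ ⟨c, rfl⟩
    exact GPath.exists_word_inv c

/-! ### The fundamental group at a maximal tree, and the development -/

variable (T : Y.MaximalTree)

/-- The fundamental group at a maximal tree `T`: the quotient of `FG(Y)` by the relations `a⁺ = 1`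
for the edges `a` of `T`. -/
abbrev TreeGroup : Type (max u v w) :=
  𝒢.FG ⧸ Subgroup.normalClosure {x | ∃ e ∈ T.edges, x = 𝒢.pos e.2.2}

/-- The projection from `FG(Y)` to the fundamental group at `T`. -/
def toTreeGroup : 𝒢.FG →* 𝒢.TreeGroup T := QuotientGroup.mk' _

theorem toTreeGroup_pos_eq_one {σ τ : Y.V} (a : Y.Edge σ τ) (ha : (⟨σ, τ, a⟩ : Y.E) ∈ T.edges) :
    𝒢.toTreeGroup T (𝒢.pos a) = 1 :=
  (QuotientGroup.eq_one_iff _).mpr (Subgroup.subset_normalClosure ⟨_, ha, rfl⟩)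

/-- The image of a local group in the fundamental group at `T`. -/
def localImage (σ : Y.V) : Subgroup (𝒢.TreeGroup T) :=
  ((𝒢.toTreeGroup T).comp (𝒢.ofLocal σ)).range

/-- The terminal vertex of an edge of the development: the map `g G_σ ↦ g a⁻ G_τ` on cosets, where
`a` is an edge of `Y` with `i(a) = σ` and `t(a) = τ`. -/
def cosetMap {σ τ : Y.V} (a : Y.Edge σ τ) :
    𝒢.TreeGroup T ⧸ 𝒢.localImage T σ → 𝒢.TreeGroup T ⧸ 𝒢.localImage T τ :=
  Quotient.map' (fun g => g * 𝒢.toTreeGroup T (𝒢.neg a)) (by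
    intro g g' h
    rw [QuotientGroup.leftRel_apply] at h ⊢
    obtain ⟨k, hk⟩ := h
    refine ⟨𝒢.ψ a k, ?_⟩
    have hk' : 𝒢.toTreeGroup T (𝒢.ofLocal σ k) = g⁻¹ * g' := hk
    simp only [MonoidHom.comp_apply, ofLocal_ψ, map_mul, map_inv, neg_eq, hk']
    group)

theorem cosetMap_mk {σ τ : Y.V} (a : Y.Edge σ τ) (g : 𝒢.TreeGroup T) :
    𝒢.cosetMap T a (QuotientGroup.mk g) =
      QuotientGroup.mk (g * 𝒢.toTreeGroup T (𝒢.neg a)) := rfl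

theorem cosetMap_comp {σ ρ τ : Y.V} (a : Y.Edge ρ τ) (b : Y.Edge σ ρ)
    (x : 𝒢.TreeGroup T ⧸ 𝒢.localImage T σ) :
    𝒢.cosetMap T (Y.comp a b) x = 𝒢.cosetMap T a (𝒢.cosetMap T b x) := by
  obtain ⟨g, rfl⟩ := QuotientGroup.mk_surjective x
  rw [cosetMap_mk, cosetMap_mk, cosetMap_mk, QuotientGroup.eq]
  refine ⟨(𝒢.twist a b)⁻¹, ?_⟩
  have h := congrArg (𝒢.toTreeGroup T) (𝒢.pos_mul_pos a b)
  simp only [map_mul] at h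
  have h' : 𝒢.toTreeGroup T (𝒢.ofLocal τ (𝒢.twist a b)) =
      𝒢.toTreeGroup T (𝒢.pos a) * 𝒢.toTreeGroup T (𝒢.pos b) *
        (𝒢.toTreeGroup T (𝒢.pos (Y.comp a b)))⁻¹ := by
    rw [h, mul_inv_cancel_right]
  simp only [MonoidHom.comp_apply, map_inv, neg_eq, h']
  group

theorem cosetMap_smul {σ τ : Y.V} (a : Y.Edge σ τ) (g : 𝒢.TreeGroup T)
    (x : 𝒢.TreeGroup T ⧸ 𝒢.localImage T σ) :
    𝒢.cosetMap T a (g • x) = g • 𝒢.cosetMap T a x := by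
  obtain ⟨k, rfl⟩ := QuotientGroup.mk_surjective x
  rw [MulAction.Quotient.smul_mk, cosetMap_mk, cosetMap_mk, MulAction.Quotient.smul_mk,
    smul_eq_mul, smul_eq_mul, mul_assoc]

/-- The development of a complex of groups. Its vertices are the pairs `(g G_σ, σ)` with `g` in the
fundamental group. Its edges are the pairs `(g G_{i(a)}, a)`, with initial vertex
`(g G_{i(a)}, i(a))` and terminal vertex `(g a⁻ G_{t(a)}, t(a))`: as the initial vertex and `a`
determine such an edge, the edges from `x` to `y` are the edges `a` of `Y` for which the terminal
vertex is `y`. The composition is `(g G_{i(a)}, a) (h G_{i(b)}, b) = (h G_{i(b)}, ab)`. -/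
def development : Scwol.{max u v w, v} where
  V := Σ σ : Y.V, 𝒢.TreeGroup T ⧸ 𝒢.localImage T σ
  Edge x y := {a : Y.Edge x.1 y.1 // 𝒢.cosetMap T a x.2 = y.2}
  comp a b := ⟨Y.comp a.1 b.1, by rw [cosetMap_comp, b.2, a.2]⟩
  comp_assoc a b c := Subtype.ext (Y.comp_assoc a.1 b.1 c.1)
  no_loops x := ⟨fun a => (Y.no_loops x.1).false a.1⟩

/-- The vertex `(g G_σ, σ)` of the development. -/
def devVertex (σ : Y.V) (g : 𝒢.TreeGroup T) : (𝒢.development T).V :=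
  ⟨σ, QuotientGroup.mk g⟩

theorem development_edge_ext {x y x' y' : (𝒢.development T).V}
    (a : (𝒢.development T).Edge x y) (a' : (𝒢.development T).Edge x' y') (hx : x = x')
    (ha : (⟨x.1, y.1, a.1⟩ : Y.E) = ⟨x'.1, y'.1, a'.1⟩) :
    (⟨x, y, a⟩ : (𝒢.development T).E) = ⟨x', y', a'⟩ := by
  subst hx
  obtain ⟨τ, q⟩ := y
  obtain ⟨τ', q'⟩ := y'
  obtain ⟨a, h3⟩ := a
  obtain ⟨a', h4⟩ := a'
  change 𝒢.cosetMap T a x.2 = q at h3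
  change 𝒢.cosetMap T a' x.2 = q' at h4
  have h := eq_of_heq (Sigma.mk.inj ha).2
  obtain ⟨h1, h2⟩ := Sigma.mk.inj h
  change τ = τ' at h1
  subst h1
  obtain rfl : a = a' := eq_of_heq h2
  obtain rfl : q = q' := h3.symm.trans h4
  rfl

/-- The fundamental group at `T` acts on the development by left multiplication. -/
instance treeGroupAction : Scwol.Action (𝒢.TreeGroup T) (𝒢.development T) where
  smul g x := ⟨x.1, g • x.2⟩
  one_smul x := Sigma.ext rfl (heq_of_eq (one_smul _ x.2))
  mul_smul g h x := Sigma.ext rfl (heq_of_eq (mul_smul g h x.2))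
  smulEdge g {x y} a := ⟨a.1, by
    change 𝒢.cosetMap T a.1 (g • x.2) = g • y.2
    rw [cosetMap_smul, a.2]⟩
  one_smulEdge {x y} a := 𝒢.development_edge_ext T _ _
    (Sigma.ext rfl (heq_of_eq (one_smul _ x.2))) rfl
  mul_smulEdge g h {x y} a := 𝒢.development_edge_ext T _ _
    (Sigma.ext rfl (heq_of_eq (mul_smul g h x.2))) rfl
  smulEdge_comp g _ _ _ a b := rfl
  smul_initial_ne_terminal g {x y} a h := by
    have h' := congrArg (fun z : (𝒢.development T).V => z.1) h
    change x.1 = y.1 at h'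
    have b : Y.Edge x.1 y.1 := a.1
    rw [h'] at b
    exact (Y.no_loops _).false b
  smulEdge_eq_of_fixed g {x y} a h := 𝒢.development_edge_ext T _ _ h rfl

/-- The fundamental group at `σ₀` acts on the development through the canonical homomorphism
to the fundamental group at `T`, which is the restriction of the projection from `FG(Y)`. -/
instance fundamentalGroupAction (σ₀ : Y.V) :
    Scwol.Action (𝒢.fundamentalGroup σ₀) (𝒢.development T) :=
  Scwol.Action.pullback (𝒢.development T)
    ((𝒢.toTreeGroup T).comp (𝒢.fundamentalGroup σ₀).subtype)

theorem smul_devVertex (σ : Y.V) (g k : 𝒢.TreeGroup T) :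
    g • 𝒢.devVertex T σ k = 𝒢.devVertex T σ (g * k) := rfl

theorem devVertex_mul_local (σ : Y.V) (g : 𝒢.TreeGroup T) (k : 𝒢.G σ) :
    𝒢.devVertex T σ (g * 𝒢.toTreeGroup T (𝒢.ofLocal σ k)) = 𝒢.devVertex T σ g :=
  Sigma.ext rfl (heq_of_eq (QuotientGroup.mk_mul_of_mem g ⟨k, rfl⟩))

theorem adj_devVertex {σ τ : Y.V} (a : Y.Edge σ τ) (g : 𝒢.TreeGroup T) :
    (𝒢.development T).skeleton.Adj (𝒢.devVertex T σ g)
      (𝒢.devVertex T τ (g * 𝒢.toTreeGroup T (𝒢.neg a))) :=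
  Or.inl ⟨⟨a, rfl⟩⟩

theorem reachable_one_one (σ τ : Y.V) :
    (𝒢.development T).skeleton.Reachable (𝒢.devVertex T σ 1) (𝒢.devVertex T τ 1) := by
  have key : ∀ {σ τ : Y.V} (a : Y.Edge σ τ), (⟨σ, τ, a⟩ : Y.E) ∈ T.edges →
      (𝒢.development T).skeleton.Adj (𝒢.devVertex T σ 1) (𝒢.devVertex T τ 1) := by
    intro σ τ a ha
    have h := 𝒢.adj_devVertex T a 1
    rwa [neg_eq, map_inv, 𝒢.toTreeGroup_pos_eq_one T a ha, inv_one, mul_one] at h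
  obtain ⟨p⟩ := T.isTree.1.preconnected σ τ
  induction p with
  | nil => exact SimpleGraph.Reachable.refl _
  | cons h p ih =>
    refine SimpleGraph.Reachable.trans ?_ ih
    rcases h with ⟨a, ha⟩ | ⟨a, ha⟩
    · exact (key a ha).reachable
    · exact (key a ha).symm.reachable

theorem reachable_toTreeGroup (x : 𝒢.FG) (σ : Y.V) :
    (𝒢.development T).skeleton.Reachable (𝒢.devVertex T σ 1)
      (𝒢.devVertex T σ (𝒢.toTreeGroup T x)) := by
  have move : ∀ (g : 𝒢.TreeGroup T) {σ τ : Y.V} {k l : 𝒢.TreeGroup T},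
      (𝒢.development T).skeleton.Reachable (𝒢.devVertex T σ k) (𝒢.devVertex T τ l) →
      (𝒢.development T).skeleton.Reachable (𝒢.devVertex T σ (g * k))
        (𝒢.devVertex T τ (g * l)) := fun g _ _ _ _ h =>
    h.map (Scwol.Action.skeletonHom (𝒢.development T) g)
  have switch : ∀ (g : 𝒢.TreeGroup T) (σ τ : Y.V),
      (𝒢.development T).skeleton.Reachable (𝒢.devVertex T σ g) (𝒢.devVertex T τ g) := by
    intro g σ τ
    simpa using move g (𝒢.reachable_one_one T σ τ)
  induction x using FG_induction generalizing σ with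
  | one => rw [map_one]
  | mul x y hx hy =>
    have h := move (𝒢.toTreeGroup T x) (hy σ)
    rw [mul_one] at h
    rw [map_mul]
    exact (hx σ).trans h
  | inv x hx =>
    have h := move (𝒢.toTreeGroup T x)⁻¹ (hx σ)
    rw [mul_one, inv_mul_cancel] at h
    rw [map_inv]
    exact h.symm
  | local_mem τ g =>
    have h := 𝒢.devVertex_mul_local T τ 1 g
    rw [one_mul] at h
    refine ((𝒢.reachable_one_one T σ τ).trans ?_).trans (switch _ τ σ)
    rw [h]
  | pos_mem a =>
    rename_i ρ τ
    have h := (𝒢.adj_devVertex T a (𝒢.toTreeGroup T (𝒢.pos a))).reachable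
    rw [neg_eq, map_inv, mul_inv_cancel] at h
    exact ((𝒢.reachable_one_one T σ τ).trans h.symm).trans (switch _ ρ σ)

theorem development_connected : (𝒢.development T).skeleton.Connected where
  preconnected := by
    have h : ∀ x : (𝒢.development T).V, ∀ σ : Y.V,
        (𝒢.development T).skeleton.Reachable (𝒢.devVertex T σ 1) x := by
      rintro ⟨τ, q⟩ σ
      obtain ⟨g, rfl⟩ := QuotientGroup.mk_surjective q
      obtain ⟨x, rfl⟩ := QuotientGroup.mk'_surjective _ g
      exact (𝒢.reachable_one_one T σ τ).trans (𝒢.reachable_toTreeGroup T x τ)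
    exact fun x y => (h x x.1).symm.trans (h y x.1)
  nonempty := by
    obtain ⟨σ⟩ := T.isTree.1.nonempty
    exact ⟨𝒢.devVertex T σ 1⟩

/-- The edge-path metric on the vertices of the development. -/
noncomputable instance developmentMetric : MetricSpace (𝒢.development T).V :=
  (𝒢.development T).edgePathMetric (𝒢.development_connected T)

instance fundamentalGroup_isometric (σ₀ : Y.V) :
    IsIsometricSMul (𝒢.fundamentalGroup σ₀) (𝒢.development T).V where
  isometry_smul g := Isometry.of_dist_eq fun x y =>
    congrArg Nat.cast (Scwol.dist_smul_eq (𝒢.development_connected T) g x y)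

/-- The base vertex `(1 G_{σ₀}, σ₀)` of the development. -/
def baseVertex (σ₀ : Y.V) : (𝒢.development T).V := 𝒢.devVertex T σ₀ 1

end ComplexOfGroups

/-- The `R`-stabilizer of a point `x₀` for an action of `Γ` on a metric space by isometries. -/
def rStabilizer (Γ : Type*) {X : Type*} [Group Γ] [MetricSpace X] [MulAction Γ X]
    [IsIsometricSMul Γ X] (x₀ : X) (R : ℝ) : Set Γ :=
  {γ | dist (γ • x₀) x₀ ≤ R}

/-! The distance d(γσ̃₀, σ̃₀) equals the least length of a `G(Y)`-loop with word γ; the theorem is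
this equality compared with R, since the reduced loops representing γ are exactly those of that
least length. One inequality follows by reading a loop as an itinerary in the development
(`GPath.exists_walk`): local elements do not move a vertex, and each oriented edge crosses one edge.
For the other, a geodesic from σ̃₀ to γσ̃₀ is read back as a `G(Y)`-loop of the same length
(`exists_gpath_of_walk`). Its word agrees with γ only in the tree group and only up to an element of
the local group at σ₀. The local factor is absorbed into the last entry of the loop. Equality then
has to be lifted from the tree group to `FG(Y)`, and this is the role of `toTreeGroup_injOn`:
twisting `FG(Y)` by a potential that trivializes the tree edges gives a homomorphism that factors
through the tree group and is the identity on words of loops at σ₀. -/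

/-! ### Potentials on trees -/

/-- On a tree, an antisymmetric group-valued function on oriented edges has a potential that is
trivial at a given vertex. -/
theorem SimpleGraph.IsTree.exists_potential {V H : Type*} [Group H] {G : SimpleGraph V}
    (hG : G.IsTree) (f : V → V → H) (hf : ∀ u v, G.Adj u v → f v u = (f u v)⁻¹) (r : V) :
    ∃ p : V → H, p r = 1 ∧ ∀ u v, G.Adj u v → p v = p u * f u v := by
  choose q hq hq' using hG.existsUnique_path r
  -- The potential at v is the ordered product of f along the path from r to v, so extending a path
  -- by one edge multiplies it on the right by one value of f.
  have concat : ∀ {u v : V} (h : G.Adj u v), q v = (q u).concat h →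
      ((q v).darts.map fun d => f d.fst d.snd).prod =
        ((q u).darts.map fun d => f d.fst d.snd).prod * f u v := by
    intro u v h e
    rw [e, SimpleGraph.Walk.darts_concat]
    simp
  refine ⟨fun v => ((q v).darts.map fun d => f d.fst d.snd).prod, ?_, fun u v h => ?_⟩
  · have e : q r = SimpleGraph.Walk.nil := (hq' r _ SimpleGraph.Walk.IsPath.nil).symm
    simp [e]
  -- Of the two paths from r to the ends of an edge of a tree, one extends the other by that edge;
  -- antisymmetry of f reduces the second case to the first.
  · by_cases hu : u ∈ (q v).support
    · exact concat h (hG.isAcyclic.path_concat (hq u) (hq v) h hu)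
    · have hv := hG.isAcyclic.mem_support_of_ne_mem_support_of_adj_of_isPath (hq u) (hq v) h hu
      have e := concat h.symm (hG.isAcyclic.path_concat (hq v) (hq u) h.symm hv)
      simp only
      rw [e, hf u v h, inv_mul_cancel_right]

/-! ### Injectivity of the map from the vertex group to the tree group -/

namespace ComplexOfGroups

variable {Y : Scwol.{u, v}} (𝒢 : ComplexOfGroups.{u, v, w} Y)

/-- The elements `a⁺` for the edges `a` of a maximal tree are the coboundary of a function on the
vertices that is trivial at the base vertex. -/
theorem exists_treePotential (T : Y.MaximalTree) (σ₀ : Y.V) :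
    ∃ p : Y.V → 𝒢.FG, p σ₀ = 1 ∧ ∀ {σ τ : Y.V} (a : Y.Edge σ τ),
      (⟨σ, τ, a⟩ : Y.E) ∈ T.edges → p σ = p τ * 𝒢.pos a := by
  classical
  let f : Y.V → Y.V → 𝒢.FG := fun x y =>
    if h : ∃ a : Y.Edge y x, (⟨y, x, a⟩ : Y.E) ∈ T.edges then 𝒢.pos h.choose else
    if h : ∃ a : Y.Edge x y, (⟨x, y, a⟩ : Y.E) ∈ T.edges then (𝒢.pos h.choose)⁻¹ else 1
  have hpos : ∀ {σ τ : Y.V} (a : Y.Edge σ τ), (⟨σ, τ, a⟩ : Y.E) ∈ T.edges →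
      f τ σ = 𝒢.pos a := by
    intro σ τ a ha
    have h : ∃ a : Y.Edge σ τ, (⟨σ, τ, a⟩ : Y.E) ∈ T.edges := ⟨a, ha⟩
    simp only [f, dif_pos h]
    rw [T.no_parallel _ a h.choose_spec ha]
  have hneg : ∀ {σ τ : Y.V} (a : Y.Edge σ τ), (⟨σ, τ, a⟩ : Y.E) ∈ T.edges →
      f σ τ = (𝒢.pos a)⁻¹ := by
    intro σ τ a ha
    have h : ∃ a : Y.Edge σ τ, (⟨σ, τ, a⟩ : Y.E) ∈ T.edges := ⟨a, ha⟩
    -- Two opposite edges would compose to a loop, so the first branch in the definition of `f`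
    -- cannot apply here.
    have h' : ¬ ∃ b : Y.Edge τ σ, (⟨τ, σ, b⟩ : Y.E) ∈ T.edges := fun ⟨b, _⟩ =>
      (Y.no_loops σ).false (Y.comp b a)
    simp only [f, dif_pos h, dif_neg h']
    rw [T.no_parallel _ a h.choose_spec ha]
  obtain ⟨p, hp, hp'⟩ := T.isTree.exists_potential f (by
    rintro x y (⟨a, ha⟩ | ⟨a, ha⟩)
    · rw [hpos a ha, hneg a ha, inv_inv]
    · rw [hpos a ha, hneg a ha]) σ₀
  refine ⟨p, hp, fun {σ τ} a ha => ?_⟩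
  rw [← hpos a ha]
  exact hp' τ σ (Or.inr ⟨a, ha⟩)

/-- The universal property of `FG(Y)`. -/
theorem exists_FG_lift {H : Type*} [Group H] (α : ∀ σ, 𝒢.G σ →* H)
    (β : ∀ {σ τ : Y.V}, Y.Edge σ τ → H)
    (hcomp : ∀ {σ ρ τ : Y.V} (a : Y.Edge ρ τ) (b : Y.Edge σ ρ),
      β a * β b = α τ (𝒢.twist a b) * β (Y.comp a b))
    (hconj : ∀ {σ τ : Y.V} (a : Y.Edge σ τ) (g : 𝒢.G σ),
      α τ (𝒢.ψ a g) = β a * α σ g * (β a)⁻¹) :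
    ∃ Φ : 𝒢.FG →* H, (∀ σ g, Φ (𝒢.ofLocal σ g) = α σ g) ∧
      ∀ {σ τ : Y.V} (a : Y.Edge σ τ), Φ (𝒢.pos a) = β a := by
  let ε : Y.OE → H := fun e =>
    match e with
    | ⟨_, _, .pos a⟩ => β a
    | ⟨_, _, .neg a⟩ => (β a)⁻¹
  let Φ₀ : 𝒢.FreeProd →* H := Monoid.Coprod.lift (Monoid.CoprodI.lift α) (FreeGroup.lift ε)
  have hlocal : ∀ σ g, Φ₀ (𝒢.preLocal σ g) = α σ g := fun σ g => by
    simp [Φ₀, preLocal]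
  have hpos : ∀ {σ τ : Y.V} (a : Y.Edge σ τ), Φ₀ (𝒢.preEdge (Y.posSymbol a)) = β a :=
    fun a => by simp [Φ₀, preEdge, ε, Scwol.posSymbol]
  have hneg : ∀ {σ τ : Y.V} (a : Y.Edge σ τ), Φ₀ (𝒢.preEdge (Y.negSymbol a)) = (β a)⁻¹ :=
    fun a => by simp [Φ₀, preEdge, ε, Scwol.negSymbol]
  have hker : Subgroup.normalClosure {x | 𝒢.FGRel x} ≤ Φ₀.ker := by
    refine Subgroup.normalClosure_le_normal ?_
    intro x hx
    change Φ₀ x = 1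
    cases hx with
    | inv_pos a => simp only [map_mul, map_inv, hpos, hneg]; group
    | inv_neg a => simp only [map_mul, map_inv, hpos, hneg]; group
    | comp a b =>
      rw [map_mul, map_inv, mul_inv_eq_one, map_mul, map_mul, hpos, hpos, hpos, hlocal]
      exact hcomp a b
    | conj a g =>
      rw [map_mul, map_inv, mul_inv_eq_one, map_mul, map_mul, hpos, hneg, hlocal, hlocal]
      exact hconj a g
  exact ⟨QuotientGroup.lift _ Φ₀ hker, hlocal, hpos⟩

/-- The canonical homomorphism from `FG(Y)` to the fundamental group at a maximal tree is injective
on the fundamental group at a vertex. -/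
theorem toTreeGroup_injOn (T : Y.MaximalTree) (σ₀ : Y.V) :
    Set.InjOn (𝒢.toTreeGroup T) (𝒢.fundamentalGroup σ₀) := by
  obtain ⟨p, hp, hpT⟩ := 𝒢.exists_treePotential T σ₀
  -- Change of gauge by the potential: local groups are conjugated by `p σ`, and a⁺ is multiplied by
  -- the values of `p` at its two ends, so that each relation of `FG(Y)` is preserved.
  obtain ⟨Φ, hlocal, hpos⟩ := 𝒢.exists_FG_lift
    (fun σ => (MulAut.conj (p σ)).toMonoidHom.comp (𝒢.ofLocal σ))
    (fun {σ τ} a => p τ * 𝒢.pos a * (p σ)⁻¹)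
    (fun {σ ρ τ} a b => by
      have h := eq_mul_inv_of_mul_eq (𝒢.pos_mul_pos a b).symm
      simp only [MonoidHom.comp_apply, MulEquiv.coe_toMonoidHom, MulAut.conj_apply, h]
      group)
    (fun a g => by
      simp only [MonoidHom.comp_apply, MulEquiv.coe_toMonoidHom, MulAut.conj_apply, ofLocal_ψ]
      group)
  -- Along a path the intermediate values of `p` cancel; on a loop at σ₀ the outer ones are trivial,
  -- so `Φ` fixes its word.
  have hword : ∀ {σ τ : Y.V} (c : 𝒢.GPath σ τ), Φ c.word = p σ * c.word * (p τ)⁻¹ := by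
    intro σ τ c
    induction c with
    | nil g => simp [GPath.word, hlocal]
    | @cons σ ρ τ g e c ih =>
      have he : Φ (𝒢.ofEdge e) = p σ * 𝒢.ofEdge e * (p ρ)⁻¹ := by
        rcases e with a | a
        · exact hpos a
        · change Φ (𝒢.neg a) = p σ * 𝒢.neg a * (p ρ)⁻¹
          rw [neg_eq, map_inv, hpos]
          group
      simp only [GPath.word, map_mul, hlocal, he, ih, MonoidHom.comp_apply,
        MulEquiv.coe_toMonoidHom, MulAut.conj_apply]
      group
  have hker : Subgroup.normalClosure {x | ∃ e ∈ T.edges, x = 𝒢.pos e.2.2} ≤ Φ.ker := by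
    refine Subgroup.normalClosure_le_normal ?_
    rintro _ ⟨⟨σ, τ, a⟩, ha, rfl⟩
    change Φ (𝒢.pos a) = 1
    rw [hpos, ← hpT a ha, mul_inv_cancel]
  rintro _ ⟨c, rfl⟩ _ ⟨d, rfl⟩ h
  -- `Φ` kills the tree edges, so its value depends only on the image in the tree group.
  have h' : Φ c.word = Φ d.word := congrArg (QuotientGroup.lift _ Φ hker) h
  simpa [hword, hp] using h'

/-! ### `G(Y)`-paths and edge paths in the development -/

namespace GPath

variable {𝒢}

theorem exists_word_mul_local {σ τ : Y.V} (c : 𝒢.GPath σ τ) (k : 𝒢.G τ) :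
    ∃ c' : 𝒢.GPath σ τ, c'.length = c.length ∧ c'.word = c.word * 𝒢.ofLocal τ k := by
  induction c with
  | nil g => exact ⟨nil (g * k), rfl, by simp [word]⟩
  | cons g e c ih =>
    obtain ⟨c', hl, hw⟩ := ih k
    exact ⟨cons g e c', by simp [length, hl], by simp [word, hw, mul_assoc]⟩

/-- A `G(Y)`-path gives edge paths of the same length in the development. -/
theorem exists_walk (T : Y.MaximalTree) {σ τ : Y.V} (c : 𝒢.GPath σ τ) (g : 𝒢.TreeGroup T) :
    ∃ q : (𝒢.development T).skeleton.Walk (𝒢.devVertex T σ g)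
      (𝒢.devVertex T τ (g * 𝒢.toTreeGroup T c.word)), q.length = c.length := by
  induction c generalizing g with
  | @nil σ k => exact ⟨SimpleGraph.Walk.nil.copy rfl (𝒢.devVertex_mul_local T σ g k).symm,
      SimpleGraph.Walk.length_copy _ _ _⟩
  | @cons σ ρ τ k e c ih =>
    have hadj : (𝒢.development T).skeleton.Adj (𝒢.devVertex T σ g)
        (𝒢.devVertex T ρ (g * 𝒢.toTreeGroup T (𝒢.ofLocal σ k) *
          𝒢.toTreeGroup T (𝒢.ofEdge e))) := by
      -- The local element only changes the representative of the starting coset. After that, a⁻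
      -- follows an edge of the development forwards and a⁺ follows one backwards.
      rw [← 𝒢.devVertex_mul_local T σ g k]
      rcases e with a | a
      · have h := (𝒢.adj_devVertex T a (g * 𝒢.toTreeGroup T (𝒢.ofLocal σ k) *
          𝒢.toTreeGroup T (𝒢.pos a))).symm
        rwa [neg_eq, map_inv, mul_inv_cancel_right] at h
      · exact 𝒢.adj_devVertex T a _
    obtain ⟨q, hq⟩ := ih (g * 𝒢.toTreeGroup T (𝒢.ofLocal σ k) * 𝒢.toTreeGroup T (𝒢.ofEdge e))
    exact ⟨(SimpleGraph.Walk.cons hadj q).copy rfl (by simp [word, mul_assoc]), by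
      simp [length, hq]⟩

end GPath

/-- An edge path in the development lifts to a `G(Y)`-path of the same length. -/
theorem exists_gpath_of_walk (T : Y.MaximalTree) {x y : (𝒢.development T).V}
    (q : (𝒢.development T).skeleton.Walk x y) (g : 𝒢.TreeGroup T)
    (hx : x.2 = QuotientGroup.mk g) :
    ∃ c : 𝒢.GPath x.1 y.1, c.length = q.length ∧
      y.2 = QuotientGroup.mk (g * 𝒢.toTreeGroup T c.word) := by
  induction q generalizing g with
  | nil => exact ⟨.nil 1, rfl, by simpa [GPath.word] using hx⟩
  | @cons x x' y h q ih =>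
    -- It is enough to lift one edge, since the induction carries along a chosen representative of
    -- the current coset.
    suffices H : ∃ (k : 𝒢.G x.1) (e : Y.OrientedEdge x.1 x'.1),
        x'.2 = QuotientGroup.mk (g * 𝒢.toTreeGroup T (𝒢.ofLocal x.1 k * 𝒢.ofEdge e)) by
      obtain ⟨k, e, he⟩ := H
      obtain ⟨c, hl, hw⟩ := ih _ he
      exact ⟨.cons k e c, by simp [GPath.length, hl], by
        rw [hw, GPath.word, map_mul _ (_ * _) c.word, mul_assoc]⟩
    rcases h with ⟨a, ha⟩ | ⟨a, ha⟩
    · refine ⟨1, .neg a, ?_⟩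
      rw [← ha, hx, map_one, one_mul]
      rfl
    · obtain ⟨g', hg'⟩ := QuotientGroup.mk_surjective x'.2
      rw [← hg', hx, cosetMap_mk, QuotientGroup.eq] at ha
      obtain ⟨k, hk⟩ := ha
      -- The edge is traversed against its direction: g'a⁻ and g represent the same coset, g =
      -- g'a⁻k, hence g' = gk⁻¹a⁺.
      refine ⟨k⁻¹, .pos a, ?_⟩
      rw [← hg']
      congr 1
      change 𝒢.toTreeGroup T (𝒢.ofLocal x.1 k) = _ at hk
      change g' = g * 𝒢.toTreeGroup T (𝒢.ofLocal x.1 k⁻¹ * 𝒢.pos a)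
      rw [map_mul, map_inv, map_inv, hk, neg_eq, map_inv]
      group

/-! ### Distance as minimal length of a loop -/

theorem dist_smul_baseVertex_le (T : Y.MaximalTree) {σ₀ : Y.V} (γ : 𝒢.fundamentalGroup σ₀)
    (c : 𝒢.GPath σ₀ σ₀) (hc : c.word = γ) :
    (𝒢.development T).skeleton.dist (γ • 𝒢.baseVertex T σ₀) (𝒢.baseVertex T σ₀) ≤ c.length := by
  obtain ⟨q, hq⟩ := c.exists_walk T 1
  rw [SimpleGraph.dist_comm, ← hq]
  have h : γ • 𝒢.baseVertex T σ₀ = 𝒢.devVertex T σ₀ (1 * 𝒢.toTreeGroup T c.word) := by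
    rw [one_mul, hc, ← mul_one (𝒢.toTreeGroup T γ)]
    rfl
  rw [h]
  exact SimpleGraph.dist_le q

/-- A geodesic determines a loop only modulo the local group at its end; correcting the last entry
costs no length, and injectivity on the vertex group turns equality in the tree group into equality
of words. -/
theorem exists_gpath_length_eq_dist (T : Y.MaximalTree) {σ₀ : Y.V} (γ : 𝒢.fundamentalGroup σ₀) :
    ∃ c : 𝒢.GPath σ₀ σ₀, c.word = γ ∧ c.length =
      (𝒢.development T).skeleton.dist (γ • 𝒢.baseVertex T σ₀) (𝒢.baseVertex T σ₀) := by
  obtain ⟨q, hq⟩ := (𝒢.development_connected T (𝒢.baseVertex T σ₀)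
    (γ • 𝒢.baseVertex T σ₀)).exists_walk_length_eq_dist
  obtain ⟨c, hl, hw⟩ := 𝒢.exists_gpath_of_walk T q 1 rfl
  change 𝒢.GPath σ₀ σ₀ at c
  change QuotientGroup.mk (𝒢.toTreeGroup T γ * 1) =
    QuotientGroup.mk (1 * 𝒢.toTreeGroup T c.word) at hw
  rw [eq_comm, QuotientGroup.eq, one_mul, mul_one] at hw
  obtain ⟨k, hk⟩ := hw
  obtain ⟨c', hl', hw'⟩ := c.exists_word_mul_local k
  refine ⟨c', 𝒢.toTreeGroup_injOn T σ₀ ⟨c', rfl⟩ γ.2 ?_, ?_⟩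
  · change 𝒢.toTreeGroup T (𝒢.ofLocal σ₀ k) = _ at hk
    rw [hw', map_mul, hk, mul_inv_cancel_left]
  · rw [hl', SimpleGraph.dist_comm, ← hq]
    exact hl

end ComplexOfGroups

theorem proposition1 {Y : Scwol.{u, v}} (𝒢 : ComplexOfGroups.{u, v, w} Y)
    (h𝒢 : 𝒢.IsDevelopable) (T : Y.MaximalTree) (σ₀ : Y.V) (R : ℝ) (hR : 0 < R) :
    rStabilizer (𝒢.fundamentalGroup σ₀) (𝒢.baseVertex T σ₀) R =
      {γ : 𝒢.fundamentalGroup σ₀ | ∃ c : 𝒢.GPath σ₀ σ₀, c.word = (γ : 𝒢.FG) ∧ c.IsReduced ∧ (c.length : ℝ) ≤ R} := by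
  ext γ
  change ((𝒢.development T).skeleton.dist (γ • 𝒢.baseVertex T σ₀) (𝒢.baseVertex T σ₀) : ℝ) ≤ R ↔
    ∃ c : 𝒢.GPath σ₀ σ₀, c.word = (γ : 𝒢.FG) ∧ c.IsReduced ∧ (c.length : ℝ) ≤ R
  constructor
  · intro h
    obtain ⟨c, hw, hl⟩ := 𝒢.exists_gpath_length_eq_dist T γ
    -- The loop read off a geodesic is reduced, because every homotopic loop also represents γ and
    -- is at least as long as the distance.
    refine ⟨c, hw, fun c' hc' => ?_, by rwa [hl]⟩
    rw [hl]
    exact 𝒢.dist_smul_baseVertex_le T γ c' (hc'.trans hw)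
  · rintro ⟨c, hw, -, hR⟩
    exact le_trans (Nat.cast_le.mpr (𝒢.dist_smul_baseVertex_le T γ c hw)) hR
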